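/- **Randen.** A state is a sequence of $16$ branches of $128$ bits; branch $0$ is the inner part, branches $1,\dots,15$ are the $1920$ outer bits. Let $\mathrm{AES}(x,k)$ be one AES round ($\mathrm{SubBytes}$, $\mathrm{ShiftRows}$, $\mathrm{MixColumns}$, then XOR with $k$) and $F(x,k)=\mathrm{AES}(\mathrm{AES}(x,k),0)$. A key $K$ consists of $17\cdot 8$ blocks $K_{r,i}$ of $128$ bits. The Randen permutation $P_K$ consists of $17$ rounds; round $r$ replaces every odd branch $s_{2i+1}$ by $F(s_{2i},K_{r,i})\oplus s_{2i+1}$ ($0\le i<8$), and then replaces branch $b$ by branch $\sigma(b)$ for all $b$, where $(\sigma(0),\dots,\sigma(15))=(7,2,13,4,11,8,3,6,15,0,9,10,1,14,5,12)$. One call of the generator with permutation $P$ replaces the state $s$ by $P(s)$ with its inner branch XORed with the inner branch of $s$, and outputs the outer bits of the new state. **Distinguishers.** A distinguisher is a Boolean circuit (arbitrary gates with two inputs, constants for free) with oracle gates that evaluate a map $P$ on states; it outputs one bit. Its work is the number of its gates plus the number of its oracle queries. Its advantage is $$\bigl|\Pr_K[D^{P_K}=1]-\Pr_\pi[D^{\pi}=1]\bigr|,$$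 where $K$ is a uniformly random key and $\pi$ a uniformly random permutation of the set of states. **Predictors.** Fix an initial state $s$ and a number $Q$ of calls of the generator with permutation $P_K$, where $K$ is uniformly random. A predictor of $m$ bits is a straight-line program whose steps are: computing a gate; reading the next bit of the output of the $Q$ calls; and, if a given wire carries $1$, stopping and predicting the values of $m$ distinct output bits, at given positions, that have not yet been read. It has no other access to the permutation, the key or the state. It succeeds if it stops with a prediction of bits among the outputs of the $Q$ calls, all of whose values are correct. The work of the attack counts $1$ for each gate, $129$ for each of the $Q$ calls (one evaluation of the permutation and $128$ XORs), and $2m+3$ for each prediction step (comparing the prediction with the output and recording the result). **Lemma (unpredictability).** Let $\varepsilon$ be a real number such that every distinguisher of work less than $2^{64}$ has advantage at most $\varepsilon$ in distinguishing the keyed Randen permutation from a random permutation. Then for every initial state $s$ and all $Q,m\ge 0$, every predictor of $m$ bits whose attack on $Q$ calls has work less than $2^{64}$ succeeds with probability at most $$2^{-m}+\varepsilon+\frac{Q^2}{2^{2048}} .$$ -/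

import Mathlib

namespace Randen

/-! ## The AES round -/

abbrev Byte := BitVec 8

/-- A 128-bit branch of the state (one AES block), little-endian: byte `i` consists of the
bits `8 * i, …, 8 * i + 7`. -/
abbrev Block := BitVec 128

/-- Multiplication by `X` in `GF(2^8) = GF(2)[X] / (X^8 + X^4 + X^3 + X + 1)`. -/
def xtime (a : Byte) : Byte := (a <<< 1) ^^^ (if a.msb then 0x1b#8 else 0#8)

/-- Multiplication in `GF(2^8)`. -/
def gfMul (a b : Byte) : Byte :=
  (List.range 8).foldl (fun acc i => acc ^^^ (if b.getLsbD i then xtime^[i] a else 0#8)) 0#8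

/-- Inversion in `GF(2^8)` (with `0 ↦ 0`), as the power `a ^ 254`. -/
def gfInv (a : Byte) : Byte := (gfMul a)^[254] 1#8

/-- The AES S-box. -/
def sbox (a : Byte) : Byte :=
  let b := gfInv a
  b ^^^ b.rotateLeft 1 ^^^ b.rotateLeft 2 ^^^ b.rotateLeft 3 ^^^ b.rotateLeft 4 ^^^ 0x63#8

/-- The byte in row `r` and column `c` of the `4 × 4` AES state; columns are contiguous. -/
def cell (x : Block) (r c : ℕ) : Byte := x.extractLsb' (8 * (r % 4 + 4 * (c % 4))) 8

/-- The block with byte `f r c` in row `r` and column `c`. -/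
def ofCells (f : ℕ → ℕ → Byte) : Block :=
  BitVec.ofFnLE fun k : Fin 128 => (f (k / 8 % 4) (k / 32)).getLsbD (k % 8)

/-- `SubBytes` followed by `ShiftRows`. -/
def subShift (x : Block) (r c : ℕ) : Byte := sbox (cell x r (c + r))

/-- One (non-final) AES round: `SubBytes`, `ShiftRows`, `MixColumns`, and XOR with the round
key. -/
def aesRound (x key : Block) : Block :=
  (ofCells fun r c =>
    gfMul 2#8 (subShift x (r % 4) c) ^^^ gfMul 3#8 (subShift x ((r + 1) % 4) c) ^^^
      subShift x ((r + 2) % 4) c ^^^ subShift x ((r + 3) % 4) c) ^^^ key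

/-! ## The Randen permutation and generator -/

/-- The 2048-bit state: 16 branches of 128 bits. -/
abbrev State := Fin 16 → Block

/-- The AES round keys: eight for each of the 17 Feistel rounds. -/
abbrev Key := Fin 17 → Fin 8 → Block

/-- The round function: two AES rounds, the second with the zero round key. -/
def F (even key : Block) : Block := aesRound (aesRound even key) 0

def roundFunctions (keys : Fin 8 → Block) (s : State) : State := fun b =>
  if b.val % 2 = 1 then
    F (s ⟨b.val - 1, by omega⟩) (keys ⟨b.val / 2, by omega⟩) ^^^ s b
  else s b

def shuffle : Fin 16 → Fin 16 := ![7, 2, 13, 4, 11, 8, 3, 6, 15, 0, 9, 10, 1, 14, 5, 12]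

def blockShuffle (s : State) : State := fun b => s (shuffle b)

/-- The keyed Randen permutation: 17 rounds. -/
def permute (K : Key) (s : State) : State :=
  (List.finRange 17).foldl (fun t r => blockShuffle (roundFunctions (K r) t)) s

/-- One step of the generator, with `P` as its permutation: apply `P`, then XOR the inner
branch with its previous value. -/
def generate (P : State → State) (s : State) : State :=
  let t := P s
  Function.update t 0 (t 0 ^^^ s 0)

/-- Bit `j` of a state. -/
def stateBit (s : State) (j : Fin 2048) : Bool :=
  (s ⟨j.val / 128, by omega⟩).getLsbD (j.val % 128)

/-- The state with given bits. -/
def ofBits (x : Fin 2048 → Bool) : State := fun b =>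
  BitVec.ofFnLE fun k : Fin 128 => x ⟨128 * b.val + k.val, by omega⟩

/-- The 1920 outer bits of a state. -/
def outer (s : State) : List Bool :=
  List.ofFn fun i : Fin 1920 => stateBit s ⟨128 + i.val, by omega⟩

/-- The output bits of the first `Q` calls of `generate`, started in state `s`. -/
def outputs (P : State → State) : (Q : ℕ) → (s : State) → List Bool
  | 0, _ => []
  | Q + 1, s => outer (generate P s) ++ outputs P Q (generate P s)

/-! ## Adversaries: Boolean circuits, written as straight-line programs

Wires are numbered in the order of their creation. Wires `0` and `1` carry the constants
`false` and `true`. -/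

/-- The value of wire `i` (`false` if there is no such wire). -/
def wire (w : List Bool) (i : ℕ) : Bool := w.getD i false

def constants : List Bool := [false, true]

/-- A gate computing an arbitrary function of two wires. -/
structure Gate where
  op : Bool → Bool → Bool
  left : ℕ
  right : ℕ

def Gate.eval (g : Gate) (w : List Bool) : Bool := g.op (wire w g.left) (wire w g.right)

/-- An instruction of a circuit with oracle access to a function on states: a gate, or the
query of the oracle at the state whose bits are carried by the given wires. -/
inductive OracleInstr where
  | gate (g : Gate)
  | query (input : Fin 2048 → ℕ)

/-- Each instruction appends the wires that it computes. -/
def OracleInstr.step (P : State → State) (w : List Bool) : OracleInstr → List Bool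
  | .gate g => w ++ [g.eval w]
  | .query input => w ++ List.ofFn (stateBit (P (ofBits fun j => wire w (input j))))

/-- A distinguisher: an oracle circuit with one output bit. -/
structure Distinguisher where
  code : List OracleInstr
  out : ℕ

/-- The distinguisher returns 1 when its oracle is `P`. -/
def Distinguisher.Accepts (D : Distinguisher) (P : State → State) : Prop :=
  wire (D.code.foldl (OracleInstr.step P) constants) D.out = true

/-- The number of gates and oracle queries. -/
def Distinguisher.work (D : Distinguisher) : ℕ := D.code.length

/-- An instruction of a predictor of `m` bits: a gate; reading the next output bit of the
generator; or, if the wire `flag` carries `true`, stopping with the prediction that, for each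
`j`, the output bit that comes `ahead j` places after the next bit to be read equals the value of
the wire `guess j`. -/
inductive PredictorInstr (m : ℕ) where
  | gate (g : Gate)
  | read
  | predict (flag : ℕ) (ahead : Fin m ↪ ℕ) (guess : Fin m → ℕ)

abbrev Predictor (m : ℕ) := List (PredictorInstr m)

/-- A run on wires `w`, where `rest` lists the output bits that have not been read. The predictor
succeeds if it stops with a correct prediction of output bits in `rest`. -/
def Predictor.SucceedsFrom {m : ℕ} : Predictor m → (w rest : List Bool) → Prop
  | [], _, _ => False
  | .gate g :: p, w, rest => SucceedsFrom p (w ++ [g.eval w]) rest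
  | .read :: p, w, rest => SucceedsFrom p (w ++ [rest.headD false]) rest.tail
  | .predict flag ahead guess :: p, w, rest =>
      if wire w flag = true then ∀ j, rest[ahead j]? = some (wire w (guess j))
      else SucceedsFrom p w rest

def Predictor.Succeeds {m : ℕ} (A : Predictor m) (output : List Bool) : Prop :=
  A.SucceedsFrom constants output

/-- Reading is free, since the production of the output is charged for separately. A prediction
is charged two gates per bit for its comparison with the output, and three for recording
whether the predictor has stopped and whether it has succeeded. -/
def PredictorInstr.cost {m : ℕ} : PredictorInstr m → ℕ
  | .gate _ => 1
  | .read => 0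
  | .predict _ _ _ => 2 * m + 3

/-- The work of an attack on `Q` calls of `generate`: each call is charged one evaluation of the
permutation and 128 XOR gates. -/
def Predictor.work {m : ℕ} (A : Predictor m) (Q : ℕ) : ℕ :=
  (A.map PredictorInstr.cost).sum + 129 * Q

/-! ## Probabilities -/

/-- The probability of `p` for a uniformly random element of the finite type `α`. -/
noncomputable def prob {α : Type} (p : α → Prop) : ℝ := (Nat.card {a // p a} : ℝ) / Nat.card α

/-- The advantage of `D` in distinguishing the Randen permutation under a uniformly random key
from a uniformly random permutation of the states. -/
noncomputable def Distinguisher.advantage (D : Distinguisher) : ℝ :=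
  |prob (fun K : Key => D.Accepts (permute K)) -
    prob (fun π : Equiv.Perm State => D.Accepts π)|

/-- The probability, over a uniformly random key, that `A` succeeds against the first `Q` output
blocks of Randen, started in state `s`. -/
noncomputable def Predictor.successProb {m : ℕ} (A : Predictor m) (Q : ℕ) (s : State) : ℝ :=
  prob fun K : Key => A.Succeeds (outputs (permute K) Q s)

end Randen

/-!
A predictor is turned into a distinguisher of exactly the same work, so that the bound follows from
its success probability against a uniformly random permutation.

*Reduction.* `toDistinguisher` simulates the `Q` calls of the generator with one query and `128`
XOR gates each, then follows the predictor. A prediction becomes a conjunction of `m` equality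
checks, computed in `2 * m` gates, and three gates that maintain two wires, "still running" and
"won". The circuit accepts with oracle `P` if and only if the predictor succeeds against `P`
(`accepts_toDistinguisher`), and its work is the work of the attack (`work_toDistinguisher`).

*Random permutation.* A sequence `v` of `Q` states is the trajectory of the generator with
permutation `π` as soon as `π` maps the input of each call to the value that the feed-forward
turns into the next state. If the `Q` inputs are distinct and the `Q` required values are distinct,
a random permutation does so with probability at least `N ^ (-Q)`, where `N = 2 ^ 2048`
(`one_div_card_le_prob_perm`). So the event that `v` is free of collisions and the predictor fails
is at least as likely for the trajectory as for a uniformly random sequence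
(`prob_le_prob_of_fiber`); this one-sided comparison is all that is needed. For a uniformly random
sequence, each of at most `Q ^ 2` possible collisions has probability `1 / N`
(`prob_collision_le`), and the output bits are independent and uniform, so that a predictor is right
with probability at most `2⁻ᵐ` (`prob_succeedsFrom_le`).
-/

namespace Randen

/-! ### Uniform probability on finite types -/

section Prob

variable {α β : Type} {p q : α → Prop}

theorem prob_mono [Finite α] (h : ∀ a, p a → q a) : prob p ≤ prob q := by
  unfold prob
  gcongr
  exact Nat.card_le_card_of_injective (Subtype.map id h)
    (Subtype.map_injective h Function.injective_id)

theorem prob_or_le [Finite α] : prob (fun a => p a ∨ q a) ≤ prob p + prob q := by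
  classical
  have := Fintype.ofFinite α
  simp only [prob, Nat.card_eq_fintype_card, Fintype.card_subtype, ← add_div, Finset.filter_or]
  gcongr
  exact_mod_cast Finset.card_union_le _ _

theorem prob_add_prob_not [Finite α] [Nonempty α] : prob p + prob (fun a => ¬p a) = 1 := by
  classical
  have := Fintype.ofFinite α
  have h0 : (Fintype.card α : ℝ) ≠ 0 := by exact_mod_cast Fintype.card_ne_zero
  simp only [prob, Nat.card_eq_fintype_card, Fintype.card_subtype, ← add_div]
  rw [div_eq_one_iff_eq h0]
  exact_mod_cast Finset.card_filter_add_card_filter_not (s := Finset.univ) p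

theorem prob_false : prob (fun _ : α => False) = 0 := by
  simp [prob]

theorem prob_exists_le [Finite α] {ι : Type} [Fintype ι] {p : ι → α → Prop} {c : ℝ}
    (h : ∀ i, prob (p i) ≤ c) : prob (fun a => ∃ i, p i a) ≤ Fintype.card ι * c := by
  have key : ∀ s : Finset ι, prob (fun a => ∃ i ∈ s, p i a) ≤ s.card * c := by
    classical
    intro s
    induction s using Finset.induction_on with
    | empty => simp [prob_false]
    | insert i s hi ih =>
      have := prob_or_le (p := p i) (q := fun a => ∃ i ∈ s, p i a)
      simp only [Finset.exists_mem_insert, Finset.card_insert_of_notMem hi]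
      push_cast
      linarith [h i]
  simpa using key Finset.univ

theorem prob_comp_equiv (e : α ≃ β) (p : β → Prop) : prob (fun a => p (e a)) = prob p := by
  unfold prob
  rw [Nat.card_congr e, Nat.card_congr (e.subtypeEquiv (q := p) fun _ => Iff.rfl)]

/-- A bound that holds conditionally on the first coordinate holds on average. -/
theorem prob_prod_le [Finite α] [Finite β] {p : α → β → Prop} {c : ℝ} (hc : 0 ≤ c)
    (h : ∀ a, prob (p a) ≤ c) : prob (fun x : α × β => p x.1 x.2) ≤ c := by
  classical
  have := Fintype.ofFinite α
  have := Fintype.ofFinite β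
  have key : Nat.card {x : α × β // p x.1 x.2} = ∑ a, Nat.card {b // p a b} := by
    rw [← Nat.card_sigma]
    exact Nat.card_congr ⟨fun x => ⟨x.1.1, x.1.2, x.2⟩, fun x => ⟨(x.1, x.2.1), x.2.2⟩,
      fun _ => rfl, fun _ => rfl⟩
  have hle : ∀ a, (Nat.card {b // p a b} : ℝ) ≤ c * Nat.card β := by
    intro a
    rcases isEmpty_or_nonempty β with hβ | hβ
    · simp
    · have h0 : (0 : ℝ) < Nat.card β := by exact_mod_cast Nat.card_pos
      exact (div_le_iff₀ h0).1 (h a)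
  unfold prob
  rw [key, Nat.card_prod]
  push_cast
  refine div_le_of_le_mul₀ (by positivity) hc ?_
  calc ∑ a, (Nat.card {b // p a b} : ℝ) ≤ ∑ _a : α, c * Nat.card β :=
        Finset.sum_le_sum fun a _ => hle a
    _ = c * (Nat.card α * Nat.card β) := by simp; ring

/-- If `T` takes each value that satisfies `q` with at least the uniform probability, then `q`
is at least as likely for `T` as it is for a uniformly random element. -/
theorem prob_le_prob_of_fiber [Finite α] [Finite β] (T : α → β) {q : β → Prop}
    (h : ∀ b, q b → 1 / (Nat.card β : ℝ) ≤ prob (fun a => T a = b)) :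
    prob q ≤ prob (fun a => q (T a)) := by
  classical
  have := Fintype.ofFinite β
  have key : Nat.card {a // q (T a)} = ∑ b : {b // q b}, Nat.card {a // T a = b} := by
    rw [← Nat.card_sigma]
    exact Nat.card_congr ⟨fun x => ⟨⟨T x.1, x.2⟩, x.1, rfl⟩,
      fun x => ⟨x.2.1, by rw [x.2.2]; exact x.1.2⟩, fun _ => rfl,
      by rintro ⟨⟨b, hb⟩, a, h⟩; dsimp only at h; subst h; rfl⟩
  calc prob q = ∑ _b : {b // q b}, 1 / (Nat.card β : ℝ) := by
        simp [prob, div_eq_mul_inv]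
    _ ≤ ∑ b : {b // q b}, prob (fun a => T a = b) := Finset.sum_le_sum fun b _ => h b b.2
    _ = prob (fun a => q (T a)) := by
        unfold prob
        rw [key, ← Finset.sum_div]
        push_cast
        rfl

end Prob

/-! ### Overwriting the values of a function on the range of an injection -/

section Extend

variable {ι κ S : Type}

theorem extend_extend (e : κ → ι) (h h' : κ → S) (v : ι → S) :
    Function.extend e h (Function.extend e h' v) = Function.extend e h v := by
  ext i
  by_cases hi : ∃ k, e k = i <;> simp [Function.extend, hi]

theorem extend_comp_self {e : κ → ι} (he : e.Injective) (v : ι → S) :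
    Function.extend e (v ∘ e) v = v := by
  ext i
  by_cases hi : ∃ k, e k = i
  · obtain ⟨k, rfl⟩ := hi
    simp [he.extend_apply]
  · simp [Function.extend, hi]

/-- A function `ι → S` amounts to its values on the range of an injection `e : κ → ι`, together
with a function for which these values have been overwritten by a prescribed `g` that depends on
the other values only. -/
noncomputable def overwriteEquiv {e : κ → ι} (he : e.Injective) (g : (ι → S) → κ → S)
    (hg : ∀ v h, g (Function.extend e h v) = g v) :
    {v : ι → S // v ∘ e = g v} × (κ → S) ≃ (ι → S) where
  toFun x := Function.extend e x.2 x.1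
  invFun w := (⟨Function.extend e (g w) w, by rw [Function.extend_comp he, hg]⟩, w ∘ e)
  left_inv := by
    rintro ⟨⟨v, hv⟩, h⟩
    simp [Function.extend_comp he, hg, extend_extend, ← hv, extend_comp_self he]
  right_inv w := by
    simp [extend_extend, extend_comp_self he]

/-- The values of a uniformly random function at `|κ|` distinct places agree with values computed
from the other places with probability `|S| ^ (-|κ|)`. -/
theorem prob_comp_eq [Finite ι] [Finite κ] [Finite S] [Nonempty S] {e : κ → ι} (he : e.Injective)
    (g : (ι → S) → κ → S) (hg : ∀ v h, g (Function.extend e h v) = g v) :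
    prob (fun v : ι → S => v ∘ e = g v) = 1 / (Nat.card (κ → S) : ℝ) := by
  have h0 : (Nat.card (κ → S) : ℝ) ≠ 0 := by exact_mod_cast Nat.card_pos.ne'
  have h1 : (Nat.card (ι → S) : ℝ) ≠ 0 := by exact_mod_cast Nat.card_pos.ne'
  have key := Nat.card_congr (overwriteEquiv he g hg)
  rw [Nat.card_prod] at key
  unfold prob
  rw [div_eq_div_iff h1 h0, one_mul]
  exact_mod_cast key

/-- The values of a uniformly random function at distinct places are uniformly random. -/
theorem prob_comp_le [Finite ι] [Finite κ] [Finite S] [Nonempty S] {e : κ → ι} (he : e.Injective)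
    (q : (κ → S) → Prop) : prob (fun v : ι → S => q (v ∘ e)) ≤ prob q := by
  have h := prob_le_prob_of_fiber (fun v : ι → S => v ∘ e) (q := fun b => ¬q b)
    fun b _ => (prob_comp_eq he (fun _ => b) fun _ _ => rfl).ge
  have h1 := prob_add_prob_not (p := fun v : ι → S => q (v ∘ e))
  have h2 := prob_add_prob_not (p := q)
  linarith

theorem prob_apply_eq [Finite ι] [Finite S] [Nonempty S] (k : ι) (g : (ι → S) → S)
    (hg : ∀ v w : ι → S, (∀ i ≠ k, v i = w i) → g v = g w) :
    prob (fun v : ι → S => v k = g v) = 1 / (Nat.card S : ℝ) := by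
  have := prob_comp_eq (e := fun _ : Unit => k) (fun _ _ _ => rfl)
    (fun v : ι → S => fun _ => g v) fun v h => by
      funext _
      refine hg _ _ fun i hi => Function.extend_apply' _ _ _ ?_
      rintro ⟨_, rfl⟩
      exact hi rfl
  simpa [funext_iff, Nat.card_fun] using this

/-- A uniformly random permutation takes prescribed distinct values at given distinct places with
at least the probability of a uniformly random function. -/
theorem one_div_card_le_prob_perm [Finite ι] [Finite S] [Nonempty S] {a b : ι → S}
    (ha : a.Injective) (hb : b.Injective) :
    1 / (Nat.card (ι → S) : ℝ) ≤ prob (fun π : Equiv.Perm S => ⇑π ∘ a = b) := by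
  classical
  have := Fintype.ofFinite ι
  have := Fintype.ofFinite S
  -- All injective value sequences `c` are taken equally often: compose with a permutation that
  -- maps `c` to `b`.
  have hle : ∀ c : ι → S, Nat.card {π : Equiv.Perm S // ⇑π ∘ a = c} ≤
      Nat.card {π : Equiv.Perm S // ⇑π ∘ a = b} := by
    intro c
    by_cases hc : c.Injective
    · obtain ⟨σ, hσ⟩ := Equiv.Perm.exists_extending_pair c b hc hb
      refine Nat.card_le_card_of_injective
        (fun π => ⟨σ * π.1, funext fun i => ?_⟩) fun π π' h => ?_
      · have := congrFun π.2 i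
        simp_all
      · exact Subtype.ext (mul_left_cancel (congrArg Subtype.val h))
    · have : IsEmpty {π : Equiv.Perm S // ⇑π ∘ a = c} :=
        ⟨fun π => hc (π.2 ▸ π.1.injective.comp ha)⟩
      simp
  have key : Nat.card (Equiv.Perm S) ≤
      Nat.card (ι → S) * Nat.card {π : Equiv.Perm S // ⇑π ∘ a = b} := by
    rw [← Nat.card_congr (Equiv.sigmaFiberEquiv fun π : Equiv.Perm S => ⇑π ∘ a), Nat.card_sigma]
    calc _ ≤ ∑ _c : ι → S, Nat.card {π : Equiv.Perm S // ⇑π ∘ a = b} :=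
          Finset.sum_le_sum fun c _ => hle c
      _ = _ := by simp [Nat.card_eq_fintype_card]
  have h0 : (0 : ℝ) < Nat.card (ι → S) := by exact_mod_cast Nat.card_pos
  have h1 : (0 : ℝ) < Nat.card (Equiv.Perm S) := by exact_mod_cast Nat.card_pos
  unfold prob
  rw [div_le_div_iff₀ h0 h1, one_mul, mul_comm]
  exact_mod_cast key

end Extend

/-! ### The bits of a state -/

theorem stateBit_ofBits (x : Fin 2048 → Bool) (j : Fin 2048) : stateBit (ofBits x) j = x j := by
  have h : j.val % 128 < 128 := Nat.mod_lt _ (by norm_num)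
  simp only [stateBit, ofBits, BitVec.getLsbD_ofFnLE, h, dif_pos]
  congr 1
  exact Fin.ext (Nat.div_add_mod _ _)

theorem ofBits_stateBit (s : State) : ofBits (stateBit s) = s := by
  funext b
  refine BitVec.eq_of_getLsbD_eq fun i hi => ?_
  have h1 : (128 * b.val + i) / 128 = b.val := by omega
  simp [ofBits, hi, stateBit, h1, Nat.mod_eq_of_lt hi]

/-- A state amounts to its `2048` bits. -/
def stateEquivBits : State ≃ (Fin 2048 → Bool) where
  toFun := stateBit
  invFun := ofBits
  left_inv := ofBits_stateBit
  right_inv x := funext (stateBit_ofBits x)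

theorem card_state : (Nat.card State : ℝ) = 2 ^ 2048 := by
  rw [Nat.card_congr stateEquivBits, Nat.card_fun, Nat.card_eq_fintype_card,
    Nat.card_eq_fintype_card, Fintype.card_bool, Fintype.card_fin, Nat.cast_pow, Nat.cast_ofNat]

/-! ### Predicting uniformly random bits -/

/-- However many bits a predictor reads first, it predicts `m` further uniformly random bits with
probability at most `2⁻ᵐ`. -/
theorem prob_succeedsFrom_le {m : ℕ} (A : Predictor m) : ∀ (w : List Bool) (n : ℕ),
    prob (fun x : Fin n → Bool => A.SucceedsFrom w (List.ofFn x)) ≤ (1 / 2 : ℝ) ^ m := by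
  induction A with
  | nil => intro w n; simp [Predictor.SucceedsFrom, prob_false]
  | cons instr A ih =>
    intro w n
    cases instr with
    | gate g => exact ih _ n
    | read =>
      cases n with
      | zero => simpa [Predictor.SucceedsFrom] using ih (w ++ [false]) 0
      | succ n =>
        rw [← prob_comp_equiv (Fin.consEquiv fun _ => Bool)]
        simp only [Predictor.SucceedsFrom, Fin.consEquiv, Equiv.coe_fn_mk, List.ofFn_succ,
          Fin.cons_zero, Fin.cons_succ, List.headD_cons, List.tail_cons]
        exact prob_prod_le (p := fun b (x : Fin n → Bool) =>
          Predictor.SucceedsFrom A (w ++ [b]) (List.ofFn x)) (by positivity) fun b => ih _ n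
    | predict flag ahead guess =>
      by_cases hf : wire w flag = true
      · simp only [Predictor.SucceedsFrom, hf, if_true]
        by_cases hn : ∀ j, ahead j < n
        · have he : Function.Injective fun j => (⟨ahead j, hn j⟩ : Fin n) := fun i j h =>
            ahead.injective (congrArg Fin.val h)
          have := prob_comp_eq he (fun _ j => wire w (guess j)) fun _ _ => rfl
          refine le_trans (prob_mono fun x hx => ?_) (this.trans_le ?_)
          · funext j
            simpa [List.getElem?_ofFn, hn j] using hx j
          · simp
        · refine le_trans (prob_mono (q := fun _ => False) fun x hx => hn fun j => ?_) ?_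
          · have := (List.getElem?_eq_some_iff.1 (hx j)).1
            simpa using this
          · rw [prob_false]; positivity
      · simpa [Predictor.SucceedsFrom, hf] using ih w n

/-- The outer bits of the states `v 0, v 1, …`. -/
def outerBits {Q : ℕ} (v : Fin Q → State) : List Bool := (List.ofFn fun i => outer (v i)).flatten

theorem prob_succeeds_outerBits_le {m : ℕ} (A : Predictor m) (Q : ℕ) :
    prob (fun v : Fin Q → State => A.Succeeds (outerBits v)) ≤ (1 / 2 : ℝ) ^ m := by
  -- The output bits are the bits of the states at distinct places.
  let E : (Fin Q → State) ≃ (Fin Q × Fin 2048 → Bool) :=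
    (Equiv.piCongrRight fun _ => stateEquivBits).trans (Equiv.curry _ _ _).symm
  let e : Fin (Q * 1920) → Fin Q × Fin 2048 := fun k =>
    ((finProdFinEquiv.symm k).1, ⟨128 + (finProdFinEquiv.symm k).2.val, by omega⟩)
  have he : e.Injective := by
    intro k k' h
    simp only [e, Prod.mk.injEq, Fin.mk.injEq, add_right_inj] at h
    exact finProdFinEquiv.symm.injective (Prod.ext h.1 (Fin.ext h.2))
  have key : ∀ v, outerBits v = List.ofFn (E v ∘ e) := by
    intro v
    rw [List.ofFn_mul, outerBits]
    refine congrArg List.flatten (congrArg List.ofFn (funext fun i =>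
      congrArg List.ofFn (funext fun j => ?_)))
    have : finProdFinEquiv.symm (⟨i * 1920 + j, by omega⟩ : Fin (Q * 1920)) = (i, j) := by
      rw [Equiv.symm_apply_eq]
      exact Fin.ext (by simp [finProdFinEquiv]; ring)
    simp only [Function.comp, e, this]
    rfl
  simp only [key, Predictor.Succeeds]
  rw [prob_comp_equiv E (fun f => A.SucceedsFrom constants (List.ofFn (f ∘ e)))]
  exact (prob_comp_le he fun x => A.SucceedsFrom constants (List.ofFn x)).trans
    (prob_succeedsFrom_le A _ _)

/-! ### The generator with a random permutation -/

/-- XOR of the inner branch of `s` into the inner branch of `t`. -/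
def addInner (s t : State) : State := Function.update t 0 (t 0 ^^^ s 0)

theorem addInner_addInner (s t : State) : addInner s (addInner s t) = t := by
  simp [addInner]

theorem generate_eq (P : State → State) (s : State) : generate P s = addInner s (P s) := rfl

/-- The states after each of the first `Q` calls of the generator. -/
def trajectory (P : State → State) (s : State) (Q : ℕ) : Fin Q → State :=
  fun i => (generate P)^[i + 1] s

theorem outputs_eq (P : State → State) (Q : ℕ) (s : State) :
    outputs P Q s = outerBits (trajectory P s Q) := by
  induction Q generalizing s with
  | zero => rfl
  | succ Q ih =>
    rw [outputs, ih]
    simp only [outerBits, List.ofFn_succ, List.flatten_cons]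
    rfl

variable {Q : ℕ}

/-- The state before call `i`, if the calls are to take the initial state `s` to
`v 0, v 1, …`. -/
def prior (s : State) (v : Fin Q → State) (i : Fin Q) : State :=
  if i.val = 0 then s else v ⟨i.val - 1, by omega⟩

/-- The value that the permutation must take at `prior s v i` in order that call `i` leads to
the state `v i`. -/
def target (s : State) (v : Fin Q → State) (i : Fin Q) : State := addInner (prior s v i) (v i)

theorem prior_congr (s : State) {v w : Fin Q → State} {i : Fin Q}
    (h : ∀ k < i, v k = w k) : prior s v i = prior s w i := by
  unfold prior
  split_ifs with h0
  · rfl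
  · exact h _ (Fin.mk_lt_of_lt_val (by omega))

/-- A permutation with the required values produces `v`. -/
theorem trajectory_eq {P : State → State} {s : State} {v : Fin Q → State}
    (h : P ∘ prior s v = target s v) : trajectory P s Q = v := by
  have step : ∀ i, v i = generate P (prior s v i) := fun i => by
    rw [generate_eq, show P (prior s v i) = target s v i from congrFun h i, target,
      addInner_addInner]
  have key : ∀ (i : ℕ) (hi : i < Q), (generate P)^[i + 1] s = v ⟨i, hi⟩ := by
    intro i
    induction i with
    | zero => intro hi; rw [step]; simp [prior]
    | succ i ih =>
      intro hi
      rw [Function.iterate_succ_apply', ih (by omega), step ⟨i + 1, hi⟩]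
      simp [prior]
  exact funext fun i => key i i.2

theorem prob_prior_eq_le (s : State) {i j : Fin Q} (hij : i < j) :
    prob (fun v : Fin Q → State => prior s v i = prior s v j) ≤ 1 / (Nat.card State : ℝ) := by
  rw [← prob_apply_eq (⟨j.val - 1, by omega⟩ : Fin Q) (fun v => prior s v i)
    fun v w h => prior_congr s fun k hk => h k ?_]
  · refine prob_mono fun v hv => ?_
    rw [hv, prior, if_neg (by have := Fin.lt_def.1 hij; omega)]
  · rintro rfl
    have := Fin.lt_def.1 hij
    have := Fin.lt_def.1 hk
    simp only at this
    omega

theorem prob_target_eq_le (s : State) {i j : Fin Q} (hij : i < j) :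
    prob (fun v : Fin Q → State => target s v i = target s v j) ≤ 1 / (Nat.card State : ℝ) := by
  rw [← prob_apply_eq j (fun v => addInner (prior s v j) (target s v i))
    fun v w h => ?_]
  · refine prob_mono fun v hv => ?_
    rw [hv, target, addInner_addInner]
  · rw [target, target, prior_congr s fun k hk => h k hk.ne,
      prior_congr s fun k hk => h k (hk.trans hij).ne, h i hij.ne]

/-- Two inputs, or two required values, of the permutation coincide with probability at most
`Q ^ 2 / 2 ^ 2048` for uniformly random states: each coincidence fixes one of the states in terms of
others. -/
theorem prob_collision_le (s : State) (Q : ℕ) :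
    prob (fun v : Fin Q → State =>
      ¬((prior s v).Injective ∧ (target s v).Injective)) ≤ (Q : ℝ) ^ 2 / Nat.card State := by
  -- The pairs above the diagonal account for the collisions of inputs, those below it for the
  -- collisions of targets.
  have key := prob_exists_le (p := fun (x : Fin Q × Fin Q) (v : Fin Q → State) =>
    (x.1 < x.2 ∧ prior s v x.1 = prior s v x.2) ∨ (x.2 < x.1 ∧ target s v x.2 = target s v x.1))
    (c := 1 / (Nat.card State : ℝ)) fun x => by
      rcases lt_trichotomy x.1 x.2 with h | h | h
      · simpa only [h, h.not_gt, true_and, false_and, or_false] using prob_prior_eq_le s h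
      · simp only [h, lt_self_iff_false, false_and, or_self, prob_false]
        positivity
      · simpa only [h, h.not_gt, true_and, false_and, false_or] using prob_target_eq_le s h
  refine le_trans (prob_mono fun v hv => ?_) (key.trans_eq ?_)
  · by_contra hne
    push Not at hne
    refine hv ⟨fun i j h => ?_, fun i j h => ?_⟩
    · rcases lt_trichotomy i j with hij | hij | hij
      · exact absurd h ((hne (i, j)).1 hij)
      · exact hij
      · exact absurd h.symm ((hne (j, i)).1 hij)
    · rcases lt_trichotomy i j with hij | hij | hij
      · exact absurd h ((hne (j, i)).2 hij)
      · exact hij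
      · exact absurd h.symm ((hne (i, j)).2 hij)
  · simp only [Fintype.card_prod, Fintype.card_fin, Nat.cast_mul]
    ring

/-- The bound of the theorem for a uniformly random permutation, without a computational
assumption. -/
theorem prob_succeeds_perm_le {m : ℕ} (A : Predictor m) (Q : ℕ) (s : State) :
    prob (fun π : Equiv.Perm State => A.Succeeds (outputs π Q s)) ≤
      (1 / 2 : ℝ) ^ m + (Q : ℝ) ^ 2 / Nat.card State := by
  have hfiber := prob_le_prob_of_fiber (fun π : Equiv.Perm State => trajectory π s Q)
    (q := fun v => ((prior s v).Injective ∧ (target s v).Injective) ∧ ¬A.Succeeds (outerBits v))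
    fun v hv => (one_div_card_le_prob_perm hv.1.1 hv.1.2).trans
      (prob_mono fun π hπ => trajectory_eq hπ)
  have hπ := hfiber.trans (prob_mono (q := fun π : Equiv.Perm State =>
    ¬A.Succeeds (outputs π Q s)) fun π h => by rw [outputs_eq]; exact h.2)
  have h1 := prob_add_prob_not (p := fun π : Equiv.Perm State => A.Succeeds (outputs π Q s))
  have h2 := prob_add_prob_not (p := fun v : Fin Q → State =>
    ((prior s v).Injective ∧ (target s v).Injective) ∧ ¬A.Succeeds (outerBits v))
  have h3 := prob_mono (p := fun v : Fin Q → State =>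
    ¬(((prior s v).Injective ∧ (target s v).Injective) ∧ ¬A.Succeeds (outerBits v)))
    (q := fun v => A.Succeeds (outerBits v) ∨
      ¬((prior s v).Injective ∧ (target s v).Injective)) fun v h => by tauto
  have h4 := h3.trans prob_or_le
  linarith [prob_succeeds_outerBits_le A Q, prob_collision_le s Q]

/-! ### Running circuits -/

/-- Wire `i` exists and carries `b`. -/
def Carries (W : List Bool) (i : ℕ) (b : Bool) : Prop := W[i]? = some b

variable {W : List Bool} {i : ℕ} {b : Bool}

theorem Carries.wire_eq (h : Carries W i b) : wire W i = b := by
  simp [wire, show W[i]? = some b from h]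

theorem Carries.eval_gate {j : ℕ} {c : Bool} (hi : Carries W i b) (hj : Carries W j c)
    (op : Bool → Bool → Bool) : Gate.eval ⟨op, i, j⟩ W = op b c := by
  rw [Gate.eval, hi.wire_eq, hj.wire_eq]

theorem Carries.lt (h : Carries W i b) : i < W.length := (List.getElem?_eq_some_iff.1 h).1

theorem Carries.append (h : Carries W i b) (X : List Bool) : Carries (W ++ X) i b := by
  rw [Carries, List.getElem?_append_left h.lt]; exact h

theorem carries_append_right {n : ℕ} (hW : W.length = n) {X : List Bool} (h : Carries X i b) :
    Carries (W ++ X) (n + i) b := by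
  subst hW
  rw [Carries, List.getElem?_append_right (by omega), Nat.add_sub_cancel_left]
  exact h

theorem carries_ofFn {k : ℕ} (f : Fin k → Bool) (i : Fin k) : Carries (List.ofFn f) i (f i) := by
  simp [Carries]

theorem carries_concat {n : ℕ} (hW : W.length = n) (b : Bool) : Carries (W ++ [b]) n b := by
  simpa using carries_append_right hW (X := [b]) (i := 0) rfl

theorem forall₂_carries_append {ρ : List ℕ} {w : List Bool} (h : List.Forall₂ (Carries W) ρ w)
    (X : List Bool) : List.Forall₂ (Carries (W ++ X)) ρ w :=
  h.imp fun _ _ hi => hi.append X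

theorem forall₂_ofFn {α β : Type} {R : α → β → Prop} {k : ℕ} {f : Fin k → α} {g : Fin k → β}
    (h : ∀ i, R (f i) (g i)) : List.Forall₂ R (List.ofFn f) (List.ofFn g) :=
  List.forall₂_iff_get.2 ⟨by simp, fun i hi _ => by simpa using h ⟨i, by simpa using hi⟩⟩

/-- The wires after running an oracle circuit on the wires `W`. -/
def exec (P : State → State) (W : List Bool) (code : List OracleInstr) : List Bool :=
  code.foldl (OracleInstr.step P) W

variable (P : State → State)

theorem exec_cons (W : List Bool) (c : OracleInstr) (code : List OracleInstr) :
    exec P W (c :: code) = exec P (c.step P W) code := rfl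

theorem exec_append (W : List Bool) (code code' : List OracleInstr) :
    exec P W (code ++ code') = exec P (exec P W code) code' := List.foldl_append

/-- Gates that read old wires only may be evaluated simultaneously. -/
theorem exec_gates_ofFn (W : List Bool) {k : ℕ} (g : Fin k → Gate)
    (hl : ∀ i, (g i).left < W.length) (hr : ∀ i, (g i).right < W.length) :
    exec P W (List.ofFn fun i => .gate (g i)) = W ++ List.ofFn fun i => (g i).eval W := by
  induction k generalizing W with
  | zero => simp [exec]
  | succ k ih =>
    have hw : ∀ (b : Bool) (i : ℕ), i < W.length → wire (W ++ [b]) i = wire W i := fun b i hi => by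
      simp [wire, List.getElem?_append_left hi]
    rw [List.ofFn_succ, exec_cons, OracleInstr.step, ih _ _
      (fun i => (hl i.succ).trans (by simp)) fun i => (hr i.succ).trans (by simp)]
    simp [List.ofFn_succ, Gate.eval, hw _ _ (hl _), hw _ _ (hr _)]

/-! ### Simulating the generator -/

/-- One call of the generator on the state carried by the wires `cur`, where `n` is the number of
existing wires: the query creates `2048` wires and the XOR of the inner branches `128` more. -/
def callCode (n : ℕ) (cur : Fin 2048 → ℕ) : List OracleInstr :=
  .query cur ::
    List.ofFn fun k : Fin 128 => .gate ⟨xor, n + k, cur (k.castLE (by norm_num))⟩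

/-- The wires that carry the state after `callCode n cur`. -/
def nextState (n : ℕ) (j : Fin 2048) : ℕ := if j.val < 128 then n + 2048 + j else n + j

/-- `Q` calls of the generator on the state carried by `cur`, with `n` existing wires. -/
def callsCode : (Q n : ℕ) → (cur : Fin 2048 → ℕ) → List OracleInstr
  | 0, _, _ => []
  | Q + 1, n, cur => callCode n cur ++ callsCode Q (n + 2176) (nextState n)

/-- The wires that carry the output bits of `Q` calls that start with `n` existing wires. -/
def outputWires : (Q n : ℕ) → List ℕ
  | 0, _ => []
  | Q + 1, n => (List.ofFn fun i : Fin 1920 => n + (128 + i)) ++ outputWires Q (n + 2176)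

theorem length_callsCode (Q n : ℕ) (cur : Fin 2048 → ℕ) :
    (callsCode Q n cur).length = 129 * Q := by
  induction Q generalizing n cur with
  | zero => rfl
  | succ Q ih =>
    rw [callsCode, callCode, List.length_append, List.length_cons, List.length_ofFn, ih]
    ring

theorem stateBit_generate (s : State) (j : Fin 2048) : stateBit (generate P s) j =
    if j.val < 128 then xor (stateBit (P s) j) (stateBit s j) else stateBit (P s) j := by
  rw [generate_eq]
  by_cases h : j.val < 128
  · have h0 : (⟨j.val / 128, by omega⟩ : Fin 16) = 0 := Fin.ext (Nat.div_eq_of_lt h)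
    simp [stateBit, addInner, h, h0]
  · have h0 : (⟨j.val / 128, by omega⟩ : Fin 16) ≠ 0 := fun h' => by
      have := congrArg Fin.val h'
      simp at this
      omega
    simp [stateBit, addInner, h]

theorem exec_callCode {n : ℕ} {cur : Fin 2048 → ℕ} {s : State} (hW : W.length = n)
    (hs : ∀ j, Carries W (cur j) (stateBit s j)) :
    ∃ X, exec P W (callCode n cur) = W ++ X ∧ X.length = 2176 ∧
      ∀ j, Carries (W ++ X) (nextState n j) (stateBit (generate P s) j) := by
  have hs' : (ofBits fun j => wire W (cur j)) = s := by
    rw [← ofBits_stateBit s]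
    exact congrArg ofBits (funext fun j => (hs j).wire_eq)
  set Y := List.ofFn (stateBit (P s)) with hY
  have hYl : (W ++ Y).length = n + 2048 := by rw [List.length_append, hY, List.length_ofFn, hW]
  have hnew : ∀ j : Fin 2048, Carries (W ++ Y) (n + j) (stateBit (P s) j) := fun j =>
    carries_append_right hW (carries_ofFn _ j)
  have hold : ∀ j, Carries (W ++ Y) (cur j) (stateBit s j) := fun j => (hs j).append Y
  refine ⟨Y ++ List.ofFn fun k : Fin 128 => xor (stateBit (P s) (k.castLE (by norm_num)))
    (stateBit s (k.castLE (by norm_num))), ?_,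
    by rw [List.length_append, hY, List.length_ofFn, List.length_ofFn], fun j => ?_⟩
  · rw [callCode, exec_cons, OracleInstr.step, hs', ← hY, exec_gates_ofFn, List.append_assoc]
    · refine congrArg (W ++ ·) (congrArg (Y ++ ·) (congrArg List.ofFn (funext fun k => ?_)))
      exact (hnew (k.castLE (by norm_num))).eval_gate (hold _) xor
    · exact fun k => (hnew (k.castLE (by norm_num))).lt
    · exact fun k => (hold _).lt
  · rw [← List.append_assoc, stateBit_generate, nextState]
    split_ifs with h
    · exact carries_append_right hYl (carries_ofFn (fun k : Fin 128 =>
        xor (stateBit (P s) (k.castLE (by norm_num))) (stateBit s (k.castLE (by norm_num))))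
        ⟨j, h⟩)
    · exact (hnew j).append _

theorem exec_callsCode (Q : ℕ) {n : ℕ} {cur : Fin 2048 → ℕ} {s : State} (hW : W.length = n)
    (hs : ∀ j, Carries W (cur j) (stateBit s j)) :
    ∃ X, exec P W (callsCode Q n cur) = W ++ X ∧ X.length = 2176 * Q ∧
      List.Forall₂ (Carries (W ++ X)) (outputWires Q n) (outputs P Q s) := by
  induction Q generalizing W n cur s with
  | zero => exact ⟨[], by simp [callsCode, exec], rfl, .nil⟩
  | succ Q ih =>
    obtain ⟨X, hX, hXl, hXs⟩ := exec_callCode P hW hs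
    obtain ⟨Y, hY, hYl, hYo⟩ := ih (W := W ++ X) (n := n + 2176) (by simp [hW, hXl]) hXs
    refine ⟨X ++ Y, ?_, by simp [hXl, hYl]; ring, ?_⟩
    · rw [callsCode, exec_append, hX, hY, List.append_assoc]
    · rw [← List.append_assoc, outputs, outputWires]
      refine List.rel_append (forall₂_carries_append ?_ Y) hYo
      refine forall₂_ofFn fun i => ?_
      have := hXs ⟨128 + i, by omega⟩
      rwa [nextState, if_neg (show ¬128 + i.val < 128 by omega)] at this

/-! ### Translating predictors into circuits -/

/-- The conjunction of the wire `a` with the values of the gates `gs`, in `2 * gs.length` gates.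
Wire `a` is the last existing wire. -/
def conjCode : (gs : List Gate) → (a : ℕ) → List OracleInstr
  | [], _ => []
  | g :: gs, a => .gate g :: .gate ⟨and, a, a + 1⟩ :: conjCode gs (a + 2)

theorem length_conjCode (gs : List Gate) (a : ℕ) : (conjCode gs a).length = 2 * gs.length := by
  induction gs generalizing a with
  | nil => rfl
  | cons g gs ih => simp [conjCode, ih]; ring

theorem Gate.eval_append {g : Gate} (hl : g.left < W.length) (hr : g.right < W.length)
    (X : List Bool) : g.eval (W ++ X) = g.eval W := by
  simp [Gate.eval, wire, List.getElem?_append_left hl, List.getElem?_append_left hr]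

theorem exec_conjCode (gs : List Gate) {a : ℕ} (hW : W.length = a + 1) (ha : Carries W a b)
    (hgs : ∀ g ∈ gs, g.left < W.length ∧ g.right < W.length) :
    ∃ X, exec P W (conjCode gs a) = W ++ X ∧ X.length = 2 * gs.length ∧
      Carries (W ++ X) (a + 2 * gs.length) (b && gs.all fun g => g.eval W) := by
  induction gs generalizing W a b with
  | nil => exact ⟨[], by simp [conjCode, exec], rfl, by simpa using ha⟩
  | cons g gs ih =>
    set V := W ++ [g.eval W] ++ [b && g.eval W] with hV
    have h1 : Carries (W ++ [g.eval W]) (a + 1) (g.eval W) := carries_concat hW _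
    have hVl : V.length = a + 2 + 1 := by simp [hV, hW]
    obtain ⟨X, hX, hXl, hXc⟩ := ih (W := V) (a := a + 2) (b := b && g.eval W) hVl
      (carries_concat (by simp [hW]) _) fun g' hg' => by
        have := hgs g' (List.mem_cons_of_mem _ hg')
        omega
    refine ⟨[g.eval W] ++ [b && g.eval W] ++ X, ?_, by simp [hXl]; ring, ?_⟩
    · rw [conjCode, exec_cons, exec_cons]
      simp only [OracleInstr.step]
      rw [(ha.append _).eval_gate h1, ← hV, hX, hV]
      simp
    · have hev : ∀ g' ∈ gs, g'.eval V = g'.eval W := fun g' hg' => by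
        have := hgs g' (List.mem_cons_of_mem _ hg')
        rw [hV, List.append_assoc, Gate.eval_append this.1 this.2]
      have hall : (gs.all fun g => g.eval V) = gs.all fun g => g.eval W := by
        rw [Bool.eq_iff_iff, List.all_eq_true, List.all_eq_true]
        exact forall₂_congr fun g' hg' => by rw [hev g' hg']
      rw [hall, hV] at hXc
      convert hXc using 1
      · simp
      · simp; ring
      · simp [Bool.and_assoc]

/-- The gate that compares a predicted wire with the output wire at its position; predictions
beyond the end of the output are wrong. -/
def checkGate (pos : Option ℕ) (guess : ℕ) : Gate :=
  match pos with
  | some i => ⟨fun x y => x == y, i, guess⟩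
  | none => ⟨fun _ _ => false, 0, 0⟩

/-- The circuit that runs a predictor when wire `ρ[i]` carries the predictor's wire `i`, the wires
`rest` carry the unread output, and `n` is the number of existing wires. The wires `live` and
`won` record whether the predictor is still running and whether it has stopped with a correct
prediction. Wire `0` carries `false`, which is what predictors read beyond the end of the output
and at missing wires. -/
def compile {m : ℕ} : Predictor m → (ρ rest : List ℕ) → (live won n : ℕ) → Distinguisher
  | [], _, _, _, won, _ => ⟨[], won⟩
  | .gate g :: A, ρ, rest, live, won, n =>
    let D := compile A (ρ ++ [n]) rest live won (n + 1)
    ⟨.gate ⟨g.op, ρ.getD g.left 0, ρ.getD g.right 0⟩ :: D.code, D.out⟩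
  | .read :: A, ρ, rest, live, won, n =>
    compile A (ρ ++ [rest.headD 0]) rest.tail live won n
  | .predict flag ahead guess :: A, ρ, rest, live, won, n =>
    let flag' := ρ.getD flag 0
    let D := compile A ρ rest (n + 2 * m + 2) (n + 2 * m + 1) (n + 2 * m + 3)
    ⟨.gate ⟨and, live, flag'⟩ ::
      (conjCode (List.ofFn fun j => checkGate rest[ahead j]? (ρ.getD (guess j) 0)) n ++
        .gate ⟨or, won, n + 2 * m⟩ :: .gate ⟨fun x y => x && !y, live, flag'⟩ :: D.code), D.out⟩

theorem length_compile {m : ℕ} (A : Predictor m) (ρ rest : List ℕ) (live won n : ℕ) :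
    (compile A ρ rest live won n).code.length = (A.map PredictorInstr.cost).sum := by
  induction A generalizing ρ rest live won n with
  | nil => rfl
  | cons c A ih =>
    cases c <;> simp [compile, ih, PredictorInstr.cost, length_conjCode] <;> ring

theorem carries_getD {ρ : List ℕ} {w : List Bool} (h0 : Carries W 0 false)
    (h : List.Forall₂ (Carries W) ρ w) (i : ℕ) : Carries W (ρ.getD i 0) (wire w i) := by
  induction h generalizing i with
  | nil => simpa [wire] using h0
  | cons h _ ih =>
    cases i with
    | zero => simpa [wire] using h
    | succ i => simpa [wire] using ih i

theorem forall₂_getElem? {ρ : List ℕ} {w : List Bool} (h : List.Forall₂ (Carries W) ρ w)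
    (i : ℕ) : Option.Rel (Carries W) ρ[i]? w[i]? := by
  induction h generalizing i with
  | nil => simp
  | cons h _ ih =>
    cases i with
    | zero => simpa using h
    | succ i => simpa using ih i

theorem eval_checkGate {pos : Option ℕ} {c : Option Bool} {g : ℕ} (h0 : Carries W 0 false)
    (hpos : Option.Rel (Carries W) pos c) (hg : Carries W g b) :
    ((checkGate pos g).left < W.length ∧ (checkGate pos g).right < W.length) ∧
      ((checkGate pos g).eval W = true ↔ c = some b) := by
  cases hpos with
  | none => simpa [checkGate, Gate.eval] using h0.lt
  | some h => simp [checkGate, Gate.eval, h.wire_eq, hg.wire_eq, h.lt, hg.lt]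

/-- The compiled circuit accepts when it had won before, or when it is still running and the
predictor goes on to succeed. -/
theorem compile_correct {m : ℕ} (A : Predictor m) {ρ rest : List ℕ} {live won n : ℕ}
    {w r : List Bool} {l v : Bool} (hW : W.length = n) (h0 : Carries W 0 false)
    (hρ : List.Forall₂ (Carries W) ρ w) (hr : List.Forall₂ (Carries W) rest r)
    (hl : Carries W live l) (hv : Carries W won v) :
    wire (exec P W (compile A ρ rest live won n).code) (compile A ρ rest live won n).out = true ↔
      v = true ∨ (l = true ∧ A.SucceedsFrom w r) := by
  induction A generalizing W ρ rest live won n w r l v with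
  | nil => simp [compile, exec, hv.wire_eq, Predictor.SucceedsFrom]
  | cons c A ih =>
    cases c with
    | gate g =>
      simp only [compile, exec_cons, OracleInstr.step, Predictor.SucceedsFrom]
      have hg : Gate.eval ⟨g.op, ρ.getD g.left 0, ρ.getD g.right 0⟩ W = g.eval w := by
        simp only [Gate.eval, (carries_getD h0 hρ _).wire_eq]
      rw [hg]
      exact ih (by simp [hW]) (h0.append _)
        (List.rel_append (forall₂_carries_append hρ _) (.cons (carries_concat hW _) .nil))
        (forall₂_carries_append hr _) (hl.append _) (hv.append _)
    | read =>
      have hread : Carries W (rest.headD 0) (r.headD false) ∧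
          List.Forall₂ (Carries W) rest.tail r.tail := by
        cases hr with
        | nil => exact ⟨h0, .nil⟩
        | cons h hr => exact ⟨h, hr⟩
      exact ih hW h0 (List.rel_append hρ (.cons hread.1 .nil)) hread.2 hl hv
    | predict flag ahead guess =>
      have hf := carries_getD h0 hρ flag
      set f := wire w flag with hfdef
      -- `gs` are the equality checks, `W₁` the wires after `live && flag`, `X` those of the
      -- conjunction, and `V` the wires after the new values of `won` and `live`.
      set gs := List.ofFn fun j => checkGate rest[ahead j]? (ρ.getD (guess j) 0) with hgs
      have hgl : gs.length = m := by simp [hgs]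
      set W₁ := W ++ [l && f] with hW₁
      have hcheck : ∀ j, _ := fun j => eval_checkGate (h0.append [l && f])
        (forall₂_getElem? (forall₂_carries_append hr [l && f]) (ahead j))
        ((carries_getD h0 hρ (guess j)).append [l && f])
      obtain ⟨X, hX, hXl, hXc⟩ := exec_conjCode P gs (W := W₁) (a := n) (by simp [hW₁, hW])
        (carries_concat hW (l && f)) (fun g hg => by
          obtain ⟨j, rfl⟩ := (List.mem_ofFn' _ _).1 hg
          exact (hcheck j).1)
      set c := gs.all fun g => g.eval W₁ with hc
      have hc' : c = true ↔ ∀ j, r[ahead j]? = some (wire w (guess j)) := by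
        rw [hc, List.all_eq_true]
        constructor
        · exact fun h j => (hcheck j).2.1 (h _ ((List.mem_ofFn' _ _).2 ⟨j, rfl⟩))
        · rintro h g hg
          obtain ⟨j, rfl⟩ := (List.mem_ofFn' _ _).1 hg
          exact (hcheck j).2.2 (h j)
      rw [hgl] at hXl hXc
      have hWX : ∀ {i b}, Carries W i b → Carries (W₁ ++ X) i b := fun h => (h.append _).append _
      set V := W₁ ++ X ++ [v || (l && f && c)] ++ [l && !f] with hVdef
      have hWV : ∀ {i b}, Carries W i b → Carries V i b := fun h =>
        ((hWX h).append _).append _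
      have hVl : V.length = n + 2 * m + 3 := by simp [hVdef, hW₁, hW, hXl]; ring
      simp only [compile, ← hgs]
      rw [exec_cons, OracleInstr.step, hl.eval_gate hf, ← hW₁, exec_append, hX, exec_cons,
        exec_cons, OracleInstr.step, OracleInstr.step, (hWX hv).eval_gate hXc,
        ((hWX hl).append _).eval_gate ((hWX hf).append _), ← hVdef,
        ih hVl (hWV h0) (hρ.imp fun _ _ => hWV) (hr.imp fun _ _ => hWV)
          (carries_concat (by simp [hW₁, hW, hXl]; ring) _)
          ((carries_concat (by simp [hW₁, hW, hXl]; ring) _).append _)]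
      rw [Predictor.SucceedsFrom, ← hfdef, ← hc']
      cases f <;> cases l <;> cases v <;> simp

/-- The distinguisher that runs `Q` calls of the generator with its oracle, from the state `s`, and
accepts when the predictor `A` succeeds on the output. -/
def toDistinguisher {m : ℕ} (A : Predictor m) (Q : ℕ) (s : State) : Distinguisher :=
  let D := compile A [0, 1] (outputWires Q 2) 1 0 (2 + 2176 * Q)
  ⟨callsCode Q 2 (fun j => if stateBit s j then 1 else 0) ++ D.code, D.out⟩

theorem work_toDistinguisher {m : ℕ} (A : Predictor m) (Q : ℕ) (s : State) :
    (toDistinguisher A Q s).work = A.work Q := by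
  simp [toDistinguisher, Distinguisher.work, Predictor.work, length_callsCode, length_compile,
    add_comm]

theorem accepts_toDistinguisher {m : ℕ} (A : Predictor m) (Q : ℕ) (s : State) :
    (toDistinguisher A Q s).Accepts P ↔ A.Succeeds (outputs P Q s) := by
  have h0 : Carries constants 0 false := rfl
  have h1 : Carries constants 1 true := rfl
  obtain ⟨X, hX, hXl, hXo⟩ := exec_callsCode P Q (W := constants) (n := 2)
    (cur := fun j => if stateBit s j then 1 else 0) (s := s) rfl fun j => by
      cases stateBit s j
      · exact h0
      · exact h1
  have := compile_correct P A (n := 2 + 2176 * Q) (by simp [constants, hXl]; ring) (h0.append X)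
    (.cons (h0.append X) (.cons (h1.append X) .nil)) hXo (h1.append X) (h0.append X)
  rw [← hX, ← exec_append] at this
  refine this.trans ?_
  simp [Predictor.Succeeds, constants]

end Randen

/-- If no distinguisher of work less than `2 ^ 64` has advantage more than `ε` against the keyed
Randen permutation, then no predictor of work less than `2 ^ 64` that sees only prior outputs
predicts `m` future output bits with probability more than `2⁻ᵐ + ε + Q² / 2 ^ 2048`. -/
theorem mainTheorem4 (ε : ℝ)
    (hindist : ∀ D : Randen.Distinguisher, D.work < 2 ^ 64 → D.advantage ≤ ε)
    (s : Randen.State) (Q m : ℕ) (A : Randen.Predictor m) (hwork : A.work Q < 2 ^ 64) :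
    A.successProb Q s ≤ (1 / 2 : ℝ) ^ m + ε + (Q : ℝ) ^ 2 / 2 ^ 2048 := by
  have hadv := (le_abs_self _).trans (hindist (Randen.toDistinguisher A Q s)
    ((Randen.work_toDistinguisher A Q s).trans_lt hwork))
  simp only [Randen.accepts_toDistinguisher] at hadv
  have hperm := Randen.prob_succeeds_perm_le A Q s
  rw [Randen.card_state] at hperm
  unfold Randen.Predictor.successProb
  generalize (Q : ℝ) ^ 2 / 2 ^ 2048 = δ at hperm ⊢
  linarith
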